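/- Let $M$ be a closed smooth manifold, i.e. a compact Hausdorff $C^\infty$ manifold of some finite dimension without boundary, and suppose that its fundamental group is nontrivial. ($M$ need not be connected; the assumption then means that $\pi_1(M,x_0)\neq\{0\}$ for at least one base point $x_0\in M$.) Let $g$ be any smooth Riemannian metric on $M$, let $d_g(x,y)\in[0,\infty]$ be the infimum of the $g$-lengths of the $C^1$ curves in $M$ from $x$ to $y$ (so that $d_g(x,y)=\infty$ exactly when $x$ and $y$ lie in different components of $M$), and let $\lambda>0$ be any real number. Then the Gaussian kernel $$k(x,y)=e^{-\lambda\, d_g(x,y)^2},\qquad x,y\in M,\qquad e^{-\infty}:=0,$$ is not positive definite. That is, it is not true that for all $N\in\mathbb N$ and all $x_1,\dots,x_N\in M$ the Gram matrix $\big(k(x_i,x_j)\big)_{1\le i,j\le N}$ is positive semidefinite. -/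

import Mathlib

open scoped Manifold ContDiff Bundle ENNReal

noncomputable section

/-- A smooth Riemannian metric on a smooth `n`-manifold `M` without boundary: a smoothly varying
family of inner products on the tangent spaces. -/
abbrev SmoothRiemannianMetric (n : ℕ) (M : Type*) [TopologicalSpace M]
    [ChartedSpace (EuclideanSpace ℝ (Fin n)) M] [IsManifold (𝓡 n) ∞ M] :=
  Bundle.ContMDiffRiemannianMetric (𝓡 n) ∞ (EuclideanSpace ℝ (Fin n))
    (fun x : M => TangentSpace (𝓡 n) x)

/-- The geodesic distance `d_g` of a Riemannian metric `g`: the infimum of the `g`-lengths of the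
`C^1` curves from `x` to `y`. It takes values in `[0, ∞]`, and it is `∞` exactly when there is no
such curve, that is, when `x` and `y` lie in different connected components of `M`. -/
def geodesicEDist {n : ℕ} {M : Type*} [TopologicalSpace M]
    [ChartedSpace (EuclideanSpace ℝ (Fin n)) M] [IsManifold (𝓡 n) ∞ M]
    (g : SmoothRiemannianMetric n M) (x y : M) : ℝ≥0∞ :=
  letI : Bundle.RiemannianBundle (fun x : M => TangentSpace (𝓡 n) x) := ⟨g.toRiemannianMetric⟩
  Manifold.riemannianEDist (𝓡 n) x y

/-- The Gaussian kernel `exp (-l * d ^ 2)` of a distance function `d` with values in `[0, ∞]`,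
where `exp (-∞) = 0`. -/
def gaussianKernel {X : Type*} (d : X → X → ℝ≥0∞) (l : ℝ) (x y : X) : ℝ :=
  open Classical in
  if d x y = ⊤ then 0 else Real.exp (-l * (d x y).toReal ^ 2)

/-- A kernel is positive definite if all its finite Gram matrices are (symmetric and) positive
semidefinite. -/
def IsPositiveDefiniteKernel {X : Type*} (k : X → X → ℝ) : Prop :=
  ∀ (N : ℕ) (x : Fin N → X), (Matrix.of fun i j => k (x i) (x j)).PosSemidef

end

/-!
The proof finds four points of `M` at which the Gram matrix is not positive semidefinite. They lie
on an almost shortest noncontractible loop, which is almost an isometrically embedded circle; no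
closed geodesic has to be constructed.

Let `L` be the infimum of the lengths of the noncontractible loops, over all base points. It is
finite because every loop is homotopic to a rectifiable one (`exists_homotopic_lengthLE`), and
positive because a loop in a sufficiently small ball is contractible, uniformly on the compact `M`
(`exists_uniformlySemilocallySimplyConnected`). Take a noncontractible loop of length `2 P` slightly
above `L`, and a chord between two points that halve it. The chord cuts the loop into two loops, at
least one of which is noncontractible (`Path.IsLengthBound.mem_noncontractibleLengths_or`), so the
chord has length at least `L - P`, which is nearly `P`.

Now let `A`, `B`, `C`, `D` be the points at arc length `0`, `h`, `P`, `P + h` along the loop. The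
sides `AB`, `BC`, `CD`, `DA` are at most `h`, `P - h`, `h`, `P - h`, and the diagonals `AC`, `BD`
are at least `L - P`. With `f u = exp (-l * u ^ 2)`, the quadratic form of the Gram matrix at
`(1, -1, 1, -1)` is therefore at most `4 * (1 - f h + f (L - P) - f (P - h))`. For `P = L / 2` and
small `h` this is negative, as `1 - f h` is of second order in `h` while `f (P - h) - f P` is of
first order; by continuity it remains negative for `P` near `L / 2`
(`exists_gaussian_four_point_neg`).

Throughout, the length of a continuous path is bounded by a continuous monotone function that
dominates its increments (`Path.IsLengthBound`). This class of paths is closed under concatenation,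
reversal and restriction, and it contains the `C^1` paths with their arc length, which gives the
link to the geodesic distance (`isLengthSpace_of_isRiemannianManifold`).
-/

/-! ### Lengths of continuous paths -/

section LengthBounds

open unitInterval Set

variable {X : Type*} [PseudoEMetricSpace X] {x y z : X}

/-- `F` dominates the length of `γ`: every increment of `γ` in the extended distance is at most the
corresponding increment of the continuous monotone function `F`. Such an `F` exists exactly for the
rectifiable paths (`F` can be the arc length), and by its continuity a path can be cut at
any prescribed value of `F`. Only the increments of `F` matter. -/
structure Path.IsLengthBound (γ : Path x y) (F : I → ℝ) : Prop where
  continuous : Continuous F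
  monotone : Monotone F
  edist_le : ∀ s t, s ≤ t → edist (γ s) (γ t) ≤ ENNReal.ofReal (F t - F s)

/-- The path `γ` has length at most `l`, witnessed by a continuous length bound. -/
def Path.LengthLE (γ : Path x y) (l : ℝ) : Prop :=
  ∃ F, γ.IsLengthBound F ∧ F 1 - F 0 ≤ l

lemma Path.LengthLE.edist_le {γ : Path x y} {l : ℝ} (h : γ.LengthLE l) (t : I) :
    edist x (γ t) ≤ ENNReal.ofReal l := by
  obtain ⟨F, hF, hl⟩ := h
  have h1 := hF.edist_le 0 t t.2.1
  rw [γ.source] at h1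
  refine h1.trans (ENNReal.ofReal_le_ofReal ?_)
  have := hF.monotone (show t ≤ 1 from t.2.2)
  linarith

lemma Path.LengthLE.symm {γ : Path x y} {l : ℝ} (h : γ.LengthLE l) : γ.symm.LengthLE l := by
  obtain ⟨F, hF, hl⟩ := h
  refine ⟨fun t => - F (σ t), ⟨by have := hF.continuous; fun_prop, ?_, ?_⟩, ?_⟩
  · intro s t hst
    exact neg_le_neg (hF.monotone (unitInterval.symm_le_symm.2 hst))
  · intro s t hst
    have := hF.edist_le (σ t) (σ s) (unitInterval.symm_le_symm.2 hst)
    rw [edist_comm] at this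
    simpa [Path.symm_apply, sub_eq_add_neg, add_comm] using this
  · simp; linarith

lemma Path.IsLengthBound.subpath {γ : Path x y} {F : I → ℝ} (hF : γ.IsLengthBound F) {s t : I}
    (hst : s ≤ t) : (γ.subpath s t).LengthLE (F t - F s) := by
  have hmono : Monotone (Icc.convexComb s t) := by
    intro a b hab
    have h1 : (a : ℝ) ≤ b := hab
    have h2 : (s : ℝ) ≤ t := hst
    change ((1 - a) * s + a * t : ℝ) ≤ (1 - b) * s + b * t
    nlinarith
  refine ⟨F ∘ Icc.convexComb s t, ⟨hF.continuous.comp (Icc.continuous_convexComb s t),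
    hF.monotone.comp hmono, fun a b hab => hF.edist_le _ _ (hmono hab)⟩, ?_⟩
  simp

lemma Path.LengthLE.trans {γ : Path x y} {γ' : Path y z} {l l' : ℝ} (h : γ.LengthLE l)
    (h' : γ'.LengthLE l') : (γ.trans γ').LengthLE (l + l') := by
  obtain ⟨F, hF, hl⟩ := h
  obtain ⟨F', hF', hl'⟩ := h'
  -- The length bound of the concatenation is the concatenation, as paths in `ℝ`, of `F` and a
  -- translate of `F'`.
  let p : Path (F 0) (F 1) := ⟨⟨F, hF.continuous⟩, rfl, rfl⟩
  let q : Path (F 1) (F' 1 + (F 1 - F' 0)) :=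
    ⟨⟨fun t => F' t + (F 1 - F' 0), by have := hF'.continuous; fun_prop⟩, by simp, rfl⟩
  have key : ∀ s t : I, s ≤ t → (p.trans q) s ≤ (p.trans q) t ∧
      edist ((γ.trans γ') s) ((γ.trans γ') t) ≤ ENNReal.ofReal ((p.trans q) t - (p.trans q) s) := by
    intro s t hst
    have hst' : (s : ℝ) ≤ t := hst
    have hb (u : I) : 0 ≤ (u : ℝ) ∧ (u : ℝ) ≤ 1 := u.2
    rw [Path.trans_apply, Path.trans_apply, Path.trans_apply, Path.trans_apply]
    by_cases ht : (t : ℝ) ≤ 1 / 2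
    · have hs : (s : ℝ) ≤ 1 / 2 := hst'.trans ht
      rw [dif_pos hs, dif_pos ht, dif_pos hs, dif_pos ht]
      have hle : (⟨2 * s, (unitInterval.mul_pos_mem_iff zero_lt_two).2 ⟨(hb s).1, hs⟩⟩ : I) ≤
          ⟨2 * t, (unitInterval.mul_pos_mem_iff zero_lt_two).2 ⟨(hb t).1, ht⟩⟩ :=
        Subtype.mk_le_mk.2 (by linarith)
      exact ⟨hF.monotone hle, hF.edist_le _ _ hle⟩
    by_cases hs : (s : ℝ) ≤ 1 / 2
    · rw [dif_pos hs, dif_neg ht, dif_pos hs, dif_neg ht]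
      set a : I := ⟨2 * s, (unitInterval.mul_pos_mem_iff zero_lt_two).2 ⟨(hb s).1, hs⟩⟩
      set b : I := ⟨2 * t - 1, unitInterval.two_mul_sub_one_mem_iff.2 ⟨(not_le.1 ht).le, (hb t).2⟩⟩
      have e1 := hF.edist_le a 1 (hb a).2
      have e2 := hF'.edist_le 0 b (hb b).1
      have m1 := hF.monotone (show a ≤ 1 from (hb a).2)
      have m2 := hF'.monotone (show 0 ≤ b from (hb b).1)
      rw [γ.target] at e1
      rw [γ'.source] at e2
      change F a ≤ F' b + (F 1 - F' 0) ∧ _ ≤ ENNReal.ofReal (F' b + (F 1 - F' 0) - F a)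
      refine ⟨by linarith, (edist_triangle _ y _).trans ((add_le_add e1 e2).trans ?_)⟩
      rw [← ENNReal.ofReal_add (by linarith) (by linarith)]
      exact ENNReal.ofReal_le_ofReal (by linarith)
    · rw [dif_neg hs, dif_neg ht, dif_neg hs, dif_neg ht]
      set a : I := ⟨2 * s - 1, unitInterval.two_mul_sub_one_mem_iff.2 ⟨(not_le.1 hs).le, (hb s).2⟩⟩
        with ha
      set b : I := ⟨2 * t - 1, unitInterval.two_mul_sub_one_mem_iff.2 ⟨(not_le.1 ht).le, (hb t).2⟩⟩
        with hb
      have hle : a ≤ b := Subtype.mk_le_mk.2 (by linarith)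
      change F' a + (F 1 - F' 0) ≤ F' b + (F 1 - F' 0) ∧
        _ ≤ ENNReal.ofReal (F' b + (F 1 - F' 0) - (F' a + (F 1 - F' 0)))
      rw [add_sub_add_right_eq_sub]
      exact ⟨by linarith [hF'.monotone hle], hF'.edist_le _ _ hle⟩
  refine ⟨p.trans q, ⟨(p.trans q).continuous, fun s t hst => (key s t hst).1,
    fun s t hst => (key s t hst).2⟩, ?_⟩
  rw [(p.trans q).source, (p.trans q).target]
  linarith

lemma Path.LengthLE.cast {γ : Path x y} {l : ℝ} (h : γ.LengthLE l) {x' y' : X} (hx : x' = x)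
    (hy : y' = y) : (γ.cast hx hy).LengthLE l := by
  subst hx hy
  exact h

/-- A path is homotopic to the concatenation of its restrictions to `[0, s]`, `[s, t]` and `[t, 1]`.
The outer two are stated with endpoints `x` and `y` instead of `γ 0` and `γ 1`. -/
lemma Path.IsLengthBound.exists_homotopic_trans_subpath {γ : Path x y} {F : I → ℝ}
    (hF : γ.IsLengthBound F) (s t : I) :
    ∃ (α : Path x (γ s)) (δ : Path (γ t) y), γ.Homotopic ((α.trans (γ.subpath s t)).trans δ) ∧
      α.LengthLE (F s - F 0) ∧ δ.LengthLE (F 1 - F t) := by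
  refine ⟨(γ.subpath 0 s).cast γ.source.symm rfl, (γ.subpath t 1).cast rfl γ.target.symm, ?_,
    (hF.subpath s.2.1).cast _ _, (hF.subpath t.2.2).cast _ _⟩
  have h1 : (((γ.subpath 0 s).trans (γ.subpath s t)).trans (γ.subpath t 1)).Homotopic
      (γ.subpath 0 1) :=
    (Path.Homotopic.hcomp ⟨Path.Homotopy.subpathTransSubpath γ 0 s t⟩
      (Path.Homotopic.refl _)).trans ⟨Path.Homotopy.subpathTransSubpath γ 0 t 1⟩
  have h2 := h1.symm.pathCast γ.source.symm γ.target.symm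
  rw [Path.subpath_zero_one] at h2
  exact h2

/-- If a chord `c` cuts the loop `αβδ` into two loops that are both contractible, then the whole
loop is contractible. -/
lemma Path.Homotopic.refl_of_shortcut {a b : X} {α : Path x a} {β c : Path a b} {δ : Path b x}
    (h1 : (β.trans c.symm).Homotopic (Path.refl a))
    (h2 : ((α.trans c).trans δ).Homotopic (Path.refl x)) :
    ((α.trans β).trans δ).Homotopic (Path.refl x) := by
  have h3 : β.Homotopic c := by
    rw [← Path.Homotopic.Quotient.eq] at *
    simp only [Path.Homotopic.Quotient.mk_trans, Path.Homotopic.Quotient.mk_symm,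
      Path.Homotopic.Quotient.mk_refl] at *
    calc Path.Homotopic.Quotient.mk β
        = ((Path.Homotopic.Quotient.mk β).trans (Path.Homotopic.Quotient.mk c).symm).trans
          (Path.Homotopic.Quotient.mk c) := by simp [Path.Homotopic.Quotient.trans_assoc]
      _ = Path.Homotopic.Quotient.mk c := by rw [h1]; simp
  exact (((Path.Homotopic.refl α).hcomp h3).hcomp (Path.Homotopic.refl δ)).trans h2

/-- All upper bounds for the lengths of noncontractible loops in `X`, the base point being
arbitrary. The infimum of this set is the systole of `X`. -/
def noncontractibleLengths (X : Type*) [PseudoEMetricSpace X] : Set ℝ :=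
  {l | ∃ (x : X) (γ : Path x x), ¬ γ.Homotopic (Path.refl x) ∧ γ.LengthLE l}

/-- A chord of length `m` cuts a noncontractible loop into two loops, of which at least one is
again noncontractible. -/
lemma Path.IsLengthBound.mem_noncontractibleLengths_or {γ : Path x x} {F : I → ℝ}
    (hF : γ.IsLengthBound F) (hγ : ¬ γ.Homotopic (Path.refl x)) {s t : I} (hst : s ≤ t)
    {c : Path (γ s) (γ t)} {m : ℝ} (hc : c.LengthLE m) :
    F t - F s + m ∈ noncontractibleLengths X ∨
      F 1 - F 0 - (F t - F s) + m ∈ noncontractibleLengths X := by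
  obtain ⟨α, δ, hh, hα, hδ⟩ := hF.exists_homotopic_trans_subpath s t
  by_cases h1 : ((γ.subpath s t).trans c.symm).Homotopic (Path.refl (γ s))
  · refine Or.inr ⟨x, (α.trans c).trans δ, fun h2 => hγ ?_, ?_⟩
    · exact hh.trans (Path.Homotopic.refl_of_shortcut h1 h2)
    · convert (hα.trans hc).trans hδ using 1
      ring
  · exact Or.inl ⟨γ s, _, h1, (hF.subpath hst).trans hc.symm⟩

/-- `X` is a length space: the distance of two points is the infimum of the lengths of the paths
between them. Only the inequality that does not hold in every metric space is required. -/
def IsLengthSpace (X : Type*) [PseudoEMetricSpace X] : Prop :=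
  ∀ (x y : X) (r : ℝ), edist x y < ENNReal.ofReal r → ∃ (γ : Path x y) (l : ℝ), l < r ∧ γ.LengthLE l

/-- Paths with the same endpoints that stay within distance `r` of their starting point are
homotopic in `X`. The homotopy need not stay near that point, whence *semilocally*. -/
def UniformlySemilocallySimplyConnected (X : Type*) [PseudoEMetricSpace X] (r : ℝ) : Prop :=
  ∀ (x y : X) (p q : Path x y), (∀ t, edist x (p t) < ENNReal.ofReal r) →
    (∀ t, edist x (q t) < ENNReal.ofReal r) → p.Homotopic q

lemma Path.LengthLE.refl (x : X) : (Path.refl x).LengthLE 0 :=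
  ⟨fun _ => 0, ⟨continuous_const, monotone_const, by simp⟩, by simp⟩

/-- Every path is homotopic to a rectifiable one: its short pieces are replaced by short
rectifiable paths with the same endpoints. -/
lemma exists_homotopic_lengthLE {r : ℝ} (hr : 0 < r) (hX : IsLengthSpace X)
    (hs : UniformlySemilocallySimplyConnected X r) (γ : Path x y) :
    ∃ (γ' : Path x y) (l : ℝ), γ.Homotopic γ' ∧ γ'.LengthLE l := by
  have hr2 : 0 < ENNReal.ofReal (r / 2) := ENNReal.ofReal_pos.2 (by linarith)
  obtain ⟨t, t0, tmono, ⟨n, hn⟩, ht⟩ := exists_monotone_Icc_subset_open_cover_unitInterval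
    (c := fun p : X => γ ⁻¹' Metric.eball p (ENNReal.ofReal (r / 2)))
    (fun p => Metric.isOpen_eball.preimage γ.continuous)
    (fun u _ => mem_iUnion.2 ⟨γ u, Metric.mem_eball_self hr2⟩)
  have hsmall (k : ℕ) (u : I) (h1 : t k ≤ u) (h2 : u ≤ t (k + 1)) :
      edist (γ (t k)) (γ u) < ENNReal.ofReal r := by
    obtain ⟨p, hp⟩ := ht k
    have e1 : edist (γ (t k)) p < _ := hp ⟨le_rfl, tmono k.le_succ⟩
    have e2 : edist (γ u) p < _ := hp ⟨h1, h2⟩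
    rw [edist_comm] at e2
    refine (edist_triangle _ p _).trans_lt ((ENNReal.add_lt_add e1 e2).trans_eq ?_)
    rw [← ENNReal.ofReal_add (by linarith) (by linarith), add_halves]
  have main (k : ℕ) : ∃ (γ' : Path (γ 0) (γ (t k))) (l : ℝ),
      (γ.subpath 0 (t k)).Homotopic γ' ∧ γ'.LengthLE l := by
    induction k with
    | zero =>
      rw [t0]
      exact ⟨Path.refl _, 0, by rw [Path.subpath_self], .refl _⟩
    | succ k ih =>
      obtain ⟨p, l, hp, hl⟩ := ih
      have hle : t k ≤ t (k + 1) := tmono k.le_succ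
      obtain ⟨q, m, hmr, hm⟩ := hX _ _ r (hsmall k _ hle le_rfl)
      refine ⟨p.trans q, l + m, ?_, hl.trans hm⟩
      have h1 : (γ.subpath (t k) (t (k + 1))).Homotopic q := by
        refine hs _ _ _ _ (fun u => hsmall k _ (Icc.le_convexComb hle u) (Icc.convexComb_le hle u))
          fun u => (hm.edist_le u).trans_lt ?_
        exact (ENNReal.ofReal_lt_ofReal_iff hr).2 hmr
      exact (Path.Homotopic.symm ⟨Path.Homotopy.subpathTransSubpath γ 0 (t k) _⟩).trans
        (hp.hcomp h1)
  have hmain := main n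
  rw [hn n le_rfl] at hmain
  obtain ⟨p, l, hp, hl⟩ := hmain
  have h2 := hp.pathCast γ.source.symm γ.target.symm
  rw [Path.subpath_zero_one] at h2
  exact ⟨_, l, h2, hl.cast _ _⟩

lemma le_of_mem_noncontractibleLengths {r : ℝ} (hr : 0 < r)
    (hs : UniformlySemilocallySimplyConnected X r) {l : ℝ} (hl : l ∈ noncontractibleLengths X) :
    r ≤ l := by
  obtain ⟨x, γ, hγ, h⟩ := hl
  by_contra! hlt
  refine hγ (hs x x _ _ (fun t => (h.edist_le t).trans_lt ?_) fun t => ?_)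
  · exact (ENNReal.ofReal_lt_ofReal_iff hr).2 hlt
  · simpa using hr

end LengthBounds

/-! ### The Gaussian kernel on four points -/

section Gaussian

/-- On a circle of length `L` the Gaussian kernel has a kink at antipodal points, of first order in
`h`, whereas at coinciding points it is flat up to second order. Hence a thin rectangle with side
`h` violates positive definiteness, and it still does so when the antipodal distance `L / 2` is
only known up to an error `ε`. -/
lemma exists_gaussian_four_point_neg {l L : ℝ} (hl : 0 < l) (hL : 0 < L) :
    ∃ h ε : ℝ, 0 < h ∧ h < L / 2 ∧ 0 < ε ∧ ∀ P, L / 2 ≤ P → P < L / 2 + ε →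
      1 - Real.exp (-l * h ^ 2) + Real.exp (-l * (L - P) ^ 2)
        - Real.exp (-l * (P - h) ^ 2) < 0 := by
  set Q := L / 2 with hQ
  have hQ0 : 0 < Q := by positivity
  set e := Real.exp (-l * Q ^ 2) with he
  have he0 : 0 < e := Real.exp_pos _
  have he1 : e < 1 := Real.exp_lt_one_iff.2 (by have : 0 < l * Q ^ 2 := by positivity
                                                linarith)
  -- The second-order loss is at most `l * h ^ 2` and the first-order gain at least
  -- `e * l * h * (2 * Q - h)`, so any `h < e * Q` works.
  set h := e * Q / 2 with hh
  have hh0 : 0 < h := by positivity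
  have hhQ : h < Q := by nlinarith
  have b1 : 1 - Real.exp (-l * h ^ 2) ≤ l * h ^ 2 := by
    linarith [Real.add_one_le_exp (-l * h ^ 2)]
  have b2 : e * (l * (2 * Q * h - h ^ 2)) ≤ Real.exp (-l * (Q - h) ^ 2) - e := by
    have : Real.exp (-l * (Q - h) ^ 2) = e * Real.exp (l * (2 * Q * h - h ^ 2)) := by
      rw [he, ← Real.exp_add]; ring_nf
    rw [this]
    nlinarith [Real.add_one_le_exp (l * (2 * Q * h - h ^ 2))]
  have b3 : l * h ^ 2 < e * (l * (2 * Q * h - h ^ 2)) := by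
    have h1 : h < e * (2 * Q - h) := by nlinarith
    have : 0 < (l * h) * (e * (2 * Q - h) - h) := mul_pos (by positivity) (by linarith)
    nlinarith
  have hc : ContinuousAt (fun P : ℝ => 1 - Real.exp (-l * h ^ 2) + Real.exp (-l * (L - P) ^ 2)
      - Real.exp (-l * (P - h) ^ 2)) Q := by fun_prop
  have hneg : 1 - Real.exp (-l * h ^ 2) + Real.exp (-l * (L - Q) ^ 2)
      - Real.exp (-l * (Q - h) ^ 2) < 0 := by
    rw [show L - Q = Q by rw [hQ]; ring, ← he]
    linarith
  obtain ⟨ε, hε, hball⟩ := Metric.eventually_nhds_iff.1 (hc.eventually_lt_const hneg)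
  refine ⟨h, ε, hh0, hhQ, hε, fun P h1 h2 => hball ?_⟩
  rw [Real.dist_eq, abs_of_nonneg] <;> linarith

variable {X : Type*} {d : X → X → ℝ≥0∞} {l : ℝ} {x y : X} {u : ℝ}

lemma exp_le_gaussianKernel (hl : 0 ≤ l) (hu : 0 ≤ u) (h : d x y ≤ ENNReal.ofReal u) :
    Real.exp (-l * u ^ 2) ≤ gaussianKernel d l x y := by
  have h1 : d x y ≠ ⊤ := (h.trans_lt ENNReal.ofReal_lt_top).ne
  have h2 : (d x y).toReal ≤ u := ENNReal.toReal_le_of_le_ofReal hu h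
  rw [gaussianKernel, if_neg h1, Real.exp_le_exp, neg_mul, neg_mul, neg_le_neg_iff]
  gcongr

lemma gaussianKernel_le_exp (hl : 0 ≤ l) (hu : 0 ≤ u) (h : ENNReal.ofReal u ≤ d x y) :
    gaussianKernel d l x y ≤ Real.exp (-l * u ^ 2) := by
  by_cases h1 : d x y = ⊤
  · rw [gaussianKernel, if_pos h1]
    positivity
  · have h2 : u ≤ (d x y).toReal := (ENNReal.ofReal_le_iff_le_toReal h1).1 h
    rw [gaussianKernel, if_neg h1, Real.exp_le_exp, neg_mul, neg_mul, neg_le_neg_iff]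
    gcongr

/-- Nonnegativity of the quadratic form of the Gram matrix at the vector `(1, -1, 1, -1)`. -/
lemma IsPositiveDefiniteKernel.four_point {k : X → X → ℝ} (hk : IsPositiveDefiniteKernel k)
    (hsymm : ∀ x y, k x y = k y x) (hdiag : ∀ x, k x x = 1) (a b c e : X) :
    k a b + k b c + k c e + k a e ≤ 2 + k a c + k b e := by
  have h := (hk 4 ![a, b, c, e]).dotProduct_mulVec_nonneg ![1, -1, 1, -1]
  simp [Matrix.mulVec, dotProduct, Fin.sum_univ_four, hdiag] at h
  rw [hsymm b a, hsymm c a, hsymm c b, hsymm e a, hsymm e b, hsymm e c] at h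
  linarith

end Gaussian

section

open unitInterval Set

/-- The metric core: in a length space that is uniformly semilocally simply connected but has a
nontrivial fundamental group, an almost shortest noncontractible loop is almost isometric to a
circle, so the Gaussian kernel is not positive definite. -/
theorem not_isPositiveDefiniteKernel_gaussianKernel_edist {X : Type*} [PseudoEMetricSpace X]
    {r : ℝ} (hr : 0 < r) (hX : IsLengthSpace X) (hs : UniformlySemilocallySimplyConnected X r)
    {x₀ : X} (hnt : Nontrivial (FundamentalGroup X x₀)) {l : ℝ} (hl : 0 < l) :
    ¬ IsPositiveDefiniteKernel (gaussianKernel (fun x y : X => edist x y) l) := by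
  intro hk
  obtain ⟨a, ha⟩ := exists_ne (1 : FundamentalGroup X x₀)
  obtain ⟨p, rfl⟩ := Path.Homotopic.Quotient.mk_surjective a
  have hp : ¬ p.Homotopic (Path.refl x₀) := fun h => ha (Path.Homotopic.Quotient.eq.2 h)
  obtain ⟨p', lp, hpp', hlp⟩ := exists_homotopic_lengthLE hr hX hs p
  have hne : (noncontractibleLengths X).Nonempty := ⟨lp, x₀, p', fun h => hp (hpp'.trans h), hlp⟩
  have hbdd : BddBelow (noncontractibleLengths X) :=
    ⟨r, fun l hl => le_of_mem_noncontractibleLengths hr hs hl⟩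
  set L := sInf (noncontractibleLengths X) with hLdef
  have hL : 0 < L := hr.trans_le (le_csInf hne fun l hl =>
    le_of_mem_noncontractibleLengths hr hs hl)
  obtain ⟨h, ε, hh0, hhL, hε, hneg⟩ := exists_gaussian_four_point_neg hl hL
  -- `2 * ε` controls the defect of the loop from being shortest; the bound `L` makes `L - P`
  -- positive below, where `2 * P` is the length of the loop.
  obtain ⟨len, hlenm, hlen⟩ := exists_lt_of_csInf_lt hne
    (show sInf (noncontractibleLengths X) < L + min (2 * ε) L by
      rw [← hLdef]; linarith [lt_min (show 0 < 2 * ε by linarith) hL])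
  obtain ⟨x, γ, hγ, F, hF, hFlen⟩ := hlenm
  have hLF : L ≤ F 1 - F 0 := csInf_le hbdd ⟨x, γ, hγ, F, hF, le_rfl⟩
  obtain ⟨P, hP⟩ : ∃ P, F 1 - F 0 = 2 * P := ⟨(F 1 - F 0) / 2, by ring⟩
  have hPε : P < L / 2 + ε := by linarith [min_le_left (2 * ε) L]
  have hPL : P < L := by linarith [min_le_right (2 * ε) L]
  have hval (u : ℝ) (h0 : 0 ≤ u) (h1 : u ≤ 2 * P) : ∃ t, F t = F 0 + u :=
    mem_range_of_exists_le_of_exists_ge hF.continuous ⟨0, by linarith⟩ ⟨1, by linarith⟩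
  obtain ⟨t₁, ht₁⟩ := hval h (by linarith) (by linarith)
  obtain ⟨t₂, ht₂⟩ := hval P (by linarith) (by linarith)
  obtain ⟨t₃, ht₃⟩ := hval (P + h) (by linarith) (by linarith)
  have h12 : t₁ ≤ t₂ := (hF.monotone.reflect_lt (by linarith)).le
  have h23 : t₂ ≤ t₃ := (hF.monotone.reflect_lt (by linarith)).le
  -- A chord between points at arc distance `P` on the loop has length at least `L - P`, since it
  -- cuts off a noncontractible loop.
  have hdiag {s t : I} (hst : s ≤ t) (hFP : F t - F s = P) :
      ENNReal.ofReal (L - P) ≤ edist (γ s) (γ t) := by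
    by_contra! hlt
    obtain ⟨c, m, hm, hc⟩ := hX _ _ _ hlt
    rcases hF.mem_noncontractibleLengths_or hγ hst hc with h | h <;>
    · have := csInf_le hbdd h
      linarith
  have e1 : edist (γ 0) (γ t₁) ≤ ENNReal.ofReal h := by
    convert hF.edist_le 0 t₁ t₁.2.1 using 2; linarith
  have e2 : edist (γ t₁) (γ t₂) ≤ ENNReal.ofReal (P - h) := by
    convert hF.edist_le _ _ h12 using 2; linarith
  have e3 : edist (γ t₂) (γ t₃) ≤ ENNReal.ofReal h := by
    convert hF.edist_le _ _ h23 using 2; linarith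
  have e4 : edist (γ 0) (γ t₃) ≤ ENNReal.ofReal (P - h) := by
    have := hF.edist_le t₃ 1 t₃.2.2
    rw [γ.target, edist_comm] at this
    rw [γ.source]
    convert this using 2; linarith
  have hfour := hk.four_point (fun x y => by simp [gaussianKernel, edist_comm])
    (fun x => by simp [gaussianKernel]) (γ 0) (γ t₁) (γ t₂) (γ t₃)
  have k1 := exp_le_gaussianKernel (d := fun x y : X => edist x y) hl.le hh0.le e1
  have k2 := exp_le_gaussianKernel (d := fun x y : X => edist x y) hl.le (by linarith) e2
  have k3 := exp_le_gaussianKernel (d := fun x y : X => edist x y) hl.le hh0.le e3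
  have k4 := exp_le_gaussianKernel (d := fun x y : X => edist x y) hl.le (by linarith) e4
  have k5 := gaussianKernel_le_exp (d := fun x y : X => edist x y) hl.le (by linarith)
    (hdiag t₂.2.1 (by linarith : F t₂ - F 0 = P))
  have k6 := gaussianKernel_le_exp (d := fun x y : X => edist x y) hl.le (by linarith)
    (hdiag (h12.trans h23) (by linarith : F t₃ - F t₁ = P))
  linarith [hneg P (by linarith) hPε]

end

/-! ### Riemannian manifolds -/

section Manifold

open Set Manifold MeasureTheory

/-- No measurability of `f` is needed, so the lemma applies to the speed of a path as it stands. -/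
lemma continuousOn_toReal_setLIntegral_Icc {f : ℝ → ℝ≥0∞} {a b : ℝ}
    (hf : ∫⁻ t in Icc a b, f t ≠ ⊤) :
    ContinuousOn (fun t => (∫⁻ u in Icc a t, f u).toReal) (Icc a b) := by
  have hfin {t : ℝ} (ht : t ≤ b) : ∫⁻ u in Icc a t, f u ≠ ⊤ :=
    ne_top_of_le_ne_top hf (lintegral_mono_set (Icc_subset_Icc_right ht))
  rw [Metric.continuousOn_iff]
  intro t₀ ht₀ ε hε
  obtain ⟨δ, hδ, hsmall⟩ := exists_pos_setLIntegral_lt_of_measure_lt hf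
    (ENNReal.ofReal_pos.2 hε).ne'
  have hinc {s t : ℝ} (hs : a ≤ s) (hst : s ≤ t) (ht : t ≤ b)
      (hd : ENNReal.ofReal (t - s) < δ) :
      (∫⁻ u in Icc a s, f u).toReal ≤ (∫⁻ u in Icc a t, f u).toReal ∧
      (∫⁻ u in Icc a t, f u).toReal < (∫⁻ u in Icc a s, f u).toReal + ε := by
    refine ⟨ENNReal.toReal_mono (hfin ht) (lintegral_mono_set (Icc_subset_Icc_right hst)), ?_⟩
    have h1 : ∫⁻ u in Ioc s t, f u < ENNReal.ofReal ε := by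
      have := hsmall (Ioc s t) ((Measure.restrict_apply_le _ _).trans_lt (by simpa using hd))
      rwa [Measure.restrict_restrict measurableSet_Ioc,
        inter_eq_left.2 (Ioc_subset_Icc_self.trans (Icc_subset_Icc hs ht))] at this
    have h2 : ∫⁻ u in Icc a t, f u = (∫⁻ u in Icc a s, f u) + ∫⁻ u in Ioc s t, f u := by
      rw [← Icc_union_Ioc_eq_Icc hs hst, lintegral_union measurableSet_Ioc]
      exact disjoint_left.2 fun u hu hu' => hu'.1.not_ge hu.2
    rw [h2, ENNReal.toReal_add (hfin (hst.trans ht)) (h1.trans ENNReal.ofReal_lt_top).ne]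
    exact add_lt_add_right ((ENNReal.lt_ofReal_iff_toReal_lt h1.ne_top).1 h1) _
  obtain ⟨η, hη, hηδ⟩ : ∃ η > 0, ENNReal.ofReal η ≤ δ := by
    rcases eq_or_ne δ ⊤ with rfl | hδt
    · exact ⟨1, one_pos, le_top⟩
    · exact ⟨δ.toReal, ENNReal.toReal_pos hδ.ne' hδt, ENNReal.ofReal_toReal_le⟩
  refine ⟨η, hη, fun t ht hdist => ?_⟩
  rw [Real.dist_eq, abs_lt] at *
  rcases le_total t₀ t with h | h
  · have := hinc ht₀.1 h ht.2 (((ENNReal.ofReal_lt_ofReal_iff hη).2 (by linarith)).trans_le hηδ)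
    constructor <;> linarith
  · have := hinc ht.1 h ht₀.2 (((ENNReal.ofReal_lt_ofReal_iff hη).2 (by linarith)).trans_le hηδ)
    constructor <;> linarith

lemma isLengthSpace_of_isRiemannianManifold {E : Type*} [NormedAddCommGroup E] [NormedSpace ℝ E]
    {H : Type*} [TopologicalSpace H] (J : ModelWithCorners ℝ E H) {M : Type*}
    [PseudoEMetricSpace M] [ChartedSpace H M]
    [Bundle.RiemannianBundle (fun x : M => TangentSpace J x)] [IsRiemannianManifold J M] :
    IsLengthSpace M := by
  intro x y r hxy
  rw [IsRiemannianManifold.out (I := J) x y] at hxy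
  obtain ⟨γ, hγ0, hγ1, hγ, hlen⟩ := exists_lt_of_riemannianEDist_lt hxy
  have hfin {t : ℝ} (ht : t ≤ 1) : pathELength J γ 0 t ≠ ⊤ :=
    ((pathELength_mono le_rfl ht).trans_lt hlen).ne_top
  let p : Path x y := ⟨⟨fun t => γ t, hγ.continuousOn.comp_continuous continuous_subtype_val
    fun t => t.2⟩, by simpa, by simpa⟩
  refine ⟨p, (pathELength J γ 0 1).toReal, (ENNReal.lt_ofReal_iff_toReal_lt hlen.ne_top).1 hlen,
    fun t => (pathELength J γ 0 t).toReal, ⟨?_, ?_, ?_⟩, by simp⟩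
  · have h1 := hfin le_rfl
    simp only [pathELength_eq_lintegral_mfderiv_Icc] at h1 ⊢
    exact (continuousOn_toReal_setLIntegral_Icc h1).comp_continuous continuous_subtype_val
      fun t => t.2
  · intro s t hst
    exact ENNReal.toReal_mono (hfin t.2.2) (pathELength_mono le_rfl hst)
  · intro s t hst
    have hst' : (s : ℝ) ≤ t := hst
    have h1 := pathELength_add (I := J) (γ := γ) s.2.1 hst'
    have h2 : pathELength J γ s t ≠ ⊤ :=
      ((pathELength_mono s.2.1 t.2.2).trans_lt hlen).ne_top
    rw [← h1, ENNReal.toReal_add (hfin s.2.2) h2, add_sub_cancel_left, ENNReal.ofReal_toReal h2,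
      IsRiemannianManifold.out (I := J)]
    exact riemannianEDist_le_pathELength (hγ.mono (Icc_subset_Icc s.2.1 t.2.2)) rfl rfl hst'

/-- Two paths with the same endpoints inside the preimage of a convex set under a chart are
homotopic. -/
lemma OpenPartialHomeomorph.homotopic_of_forall_mem_convex {M E : Type*} [TopologicalSpace M]
    [NormedAddCommGroup E] [NormedSpace ℝ E] (φ : OpenPartialHomeomorph M E) {B : Set E}
    (hB : Convex ℝ B) (hBφ : B ⊆ φ.target) {x y : M} (p q : Path x y)
    (hp : ∀ t, p t ∈ φ.source ∩ φ ⁻¹' B) (hq : ∀ t, q t ∈ φ.source ∩ φ ⁻¹' B) :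
    p.Homotopic q := by
  have hx : φ x ∈ B := by simpa using (hp 0).2
  have hy : φ y ∈ B := by simpa using (hp 1).2
  have : ContractibleSpace B := hB.contractibleSpace ⟨_, hx⟩
  let lift (p : Path x y) (hp : ∀ t, p t ∈ φ.source ∩ φ ⁻¹' B) :
      Path (⟨φ x, hx⟩ : B) ⟨φ y, hy⟩ :=
    ⟨⟨fun t => ⟨φ (p t), (hp t).2⟩, Continuous.subtype_mk
      (φ.continuousOn.comp_continuous p.continuous fun t => (hp t).1) _⟩, by simp, by simp⟩
  let ψ : C(B, M) := ⟨fun b => φ.symm b,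
    φ.continuousOn_symm.comp_continuous continuous_subtype_val fun b => hBφ b.2⟩
  have h1 := (SimplyConnectedSpace.paths_homotopic (lift p hp) (lift q hq)).map ψ
  have hx' : x = φ.symm (φ x) := (φ.left_inv (by simpa using (hp 0).1)).symm
  have hy' : y = φ.symm (φ y) := (φ.left_inv (by simpa using (hp 1).1)).symm
  have h2 := h1.pathCast hx' hy'
  convert h2 using 1
  · ext t
    exact (φ.left_inv (hp t).1).symm
  · ext t
    exact (φ.left_inv (hq t).1).symm

/-- A Lebesgue number of the cover by preimages of balls under the charts serves as the radius. -/
lemma exists_uniformlySemilocallySimplyConnected (E : Type*) [NormedAddCommGroup E]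
    [NormedSpace ℝ E] (M : Type*) [PseudoEMetricSpace M] [CompactSpace M] [ChartedSpace E M] :
    ∃ r > 0, UniformlySemilocallySimplyConnected M r := by
  have hchart (z : M) : ∃ ρ > 0, Metric.ball (chartAt E z z) ρ ⊆ (chartAt E z).target :=
    Metric.isOpen_iff.1 (chartAt E z).open_target _ (mem_chart_target E z)
  choose ρ hρ hball using hchart
  obtain ⟨δ, hδ, hleb⟩ := lebesgue_number_lemma_of_emetric (s := (univ : Set M)) isCompact_univ
    (c := fun z : M => (chartAt E z).source ∩ chartAt E z ⁻¹' Metric.ball (chartAt E z z) (ρ z))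
    (fun z => (chartAt E z).isOpen_inter_preimage Metric.isOpen_ball)
    (fun z _ => mem_iUnion.2 ⟨z, mem_chart_source E z, Metric.mem_ball_self (hρ z)⟩)
  obtain ⟨r, hr, hrδ⟩ : ∃ r > 0, ENNReal.ofReal r ≤ δ := by
    rcases eq_or_ne δ ⊤ with rfl | hδt
    · exact ⟨1, one_pos, le_top⟩
    · exact ⟨δ.toReal, ENNReal.toReal_pos hδ.ne' hδt, ENNReal.ofReal_toReal_le⟩
  refine ⟨r, hr, fun x y p q hp hq => ?_⟩
  obtain ⟨z, hz⟩ := hleb x (mem_univ x)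
  exact (chartAt E z).homotopic_of_forall_mem_convex (convex_ball _ _) (hball z) p q
    (fun t => hz (by rw [Metric.mem_eball, edist_comm]; exact (hp t).trans_le hrδ))
    (fun t => hz (by rw [Metric.mem_eball, edist_comm]; exact (hq t).trans_le hrδ))

end Manifold

theorem theorem3p1 (n : ℕ) (M : Type*) [TopologicalSpace M] [T2Space M] [CompactSpace M]
    [ChartedSpace (EuclideanSpace ℝ (Fin n)) M] [IsManifold (𝓡 n) ∞ M]
    (hM : ∃ x₀ : M, Nontrivial (FundamentalGroup M x₀))
    (g : SmoothRiemannianMetric n M) (l : ℝ) (hl : 0 < l) :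
    ¬ IsPositiveDefiniteKernel (gaussianKernel (geodesicEDist g) l) := by
  obtain ⟨x₀, hx₀⟩ := hM
  let : Bundle.RiemannianBundle (fun x : M => TangentSpace (𝓡 n) x) := ⟨g.toRiemannianMetric⟩
  have : IsContinuousRiemannianBundle (EuclideanSpace ℝ (Fin n))
      (fun x : M => TangentSpace (𝓡 n) x) :=
    ⟨g.inner, g.contMDiff.continuous, fun _ _ _ => rfl⟩
  let : PseudoEMetricSpace M := .ofRiemannianMetric (𝓡 n) M
  obtain ⟨r, hr, hs⟩ := exists_uniformlySemilocallySimplyConnected (EuclideanSpace ℝ (Fin n)) M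
  exact not_isPositiveDefiniteKernel_gaussianKernel_edist hr
    (isLengthSpace_of_isRiemannianManifold (𝓡 n)) hs hx₀ hl
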